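/- **Theorem (Asymptotic normality of the log of the norm of the network output, ReLU).** Let $d\ge 1$, $\sigma>0$, and let $x^{(0)}\in\mathbb{R}^d$ with $x^{(0)}\neq 0$. Consider the fully connected ReLU network of width $d$, $x^{(k+1)}=\phi_0\big(W^{(k+1)}x^{(k)}+b^{(k+1)}\big)$ for $k\ge 0$, where $\phi_0(z)=\max(z,0)$ acts componentwise, all biases vanish ($b^{(k)}=0$), and all entries $W^{(k)}_{ij}$ ($k\ge 1$, $1\le i,j\le d$) of the weight matrices are independent with law $\mathcal N(0,\sigma^2)$. Then $\mathbb{P}(x^{(k)}\ne 0)>0$ for every $k$. Let $R_{k,0}$, $k\ge 0$, be random variables on a common probability space (with an arbitrary joint law) such that, for each $k$, the law of $R_{k,0}$ is the conditional law of $\log\|x^{(k)}\|$ given $x^{(k)}\neq 0$, where $\|\cdot\|$ is the Euclidean norm. Write $\psi_0=\Gamma'/\Gamma$ for the digamma function, $\psi_1=\psi_0'$ for the trigamma function, and $\pi_d(n)=\binom dn\frac1{2^d-1}$. Then, almost surely, $$\lim_{k\to\infty}\frac{R_{k,0}}{k}=\mu_0(\sigma):=\log\sigma+\frac12\sum_{n=1}^d\pi_d(n)\Big[\log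 2+\psi_0\big(\tfrac n2\big)\Big];$$ in particular the limit is deterministic and does not depend on $x^{(0)}$. Moreover $$\frac{R_{k,0}-\mu_0(\sigma)k}{\sqrt k}\Rightarrow\mathcal N(0,s_0^2)\quad\text{in distribution as }k\to\infty,$$ where $$s_0^2=\frac14\sum_{n=1}^d\pi_d(n)\Big[\psi_1\big(\tfrac n2\big)+\big[\log 2+\psi_0\big(\tfrac n2\big)\big]^2\Big]-\frac14\Big(\sum_{n=1}^d\pi_d(n)\big[\log 2+\psi_0\big(\tfrac n2\big)\big]\Big)^2\ \ge 0 .$$ -/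

import Mathlib

open MeasureTheory ProbabilityTheory Filter Topology

namespace GaussianNet

noncomputable section

/-- The ReLU activation function `φ₀(z) = max(z, 0)`. -/
def relu (z : ℝ) : ℝ := max z 0

/-- One fully connected layer `x ↦ φ(W x + b)` of width `d`, with the activation `φ` applied
componentwise. -/
def layer {d : ℕ} (φ : ℝ → ℝ) (W : Matrix (Fin d) (Fin d) ℝ) (b : EuclideanSpace ℝ (Fin d))
    (x : EuclideanSpace ℝ (Fin d)) : EuclideanSpace ℝ (Fin d) :=
  WithLp.toLp 2 fun i => φ ((∑ j, W i j * x j) + b i)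

/-- The output `x⁽ᵏ⁾` of the `k`-th layer on the input `x⁽⁰⁾`. Here `W k` and `b k` are the weight
matrix and the bias of layer number `k + 1`, so that `x⁽ᵏ⁺¹⁾ = φ(W k x⁽ᵏ⁾ + b k)`. -/
def output {d : ℕ} (φ : ℝ → ℝ) (W : ℕ → Matrix (Fin d) (Fin d) ℝ)
    (b : ℕ → EuclideanSpace ℝ (Fin d)) (x₀ : EuclideanSpace ℝ (Fin d)) :
    ℕ → EuclideanSpace ℝ (Fin d)
  | 0 => x₀
  | k + 1 => layer φ (W k) (b k) (output φ W b x₀ k)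

/-- The conditional law of `log ‖X‖` given `X ≠ 0`, for a random vector `X` under `P`. -/
def condLogNormLaw {Ω : Type*} [MeasurableSpace Ω] (P : Measure Ω) {d : ℕ}
    (X : Ω → EuclideanSpace ℝ (Fin d)) : Measure ℝ :=
  (P[|{ω | X ω ≠ 0}]).map fun ω => Real.log ‖X ω‖

/-- The digamma function `ψ₀ = Γ' / Γ` of a real variable. -/
def digamma (x : ℝ) : ℝ := logDeriv Real.Gamma x

/-- The trigamma function `ψ₁ = ψ₀'` of a real variable. -/
def trigamma (x : ℝ) : ℝ := deriv digamma x

/-- On the positive reals, `digamma` agrees with the complex digamma function of Mathlib. -/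
theorem ofReal_digamma {x : ℝ} (hx : 0 < x) : (digamma x : ℂ) = Complex.digamma (x : ℂ) := by
  have hne : ∀ m : ℕ, (x : ℂ) ≠ -m := by
    intro m h
    have h' : x = -(m : ℝ) := by exact_mod_cast h
    have : (0 : ℝ) ≤ m := Nat.cast_nonneg m
    linarith
  have hc : HasDerivAt Complex.Gamma (deriv Complex.Gamma (x : ℂ)) (x : ℂ) :=
    (Complex.differentiableAt_Gamma _ hne).hasDerivAt
  have h1 : HasDerivAt (fun t : ℝ => Complex.Gamma (t : ℂ)) (deriv Complex.Gamma (x : ℂ)) x :=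
    hc.comp_ofReal
  have h2 : HasDerivAt (fun t : ℝ => Complex.Gamma (t : ℂ)) ((deriv Real.Gamma x : ℝ) : ℂ) x := by
    have hr : DifferentiableAt ℝ Real.Gamma x :=
      Real.differentiableAt_Gamma fun m h => hne m (by rw [h]; push_cast; rfl)
    simpa only [Complex.Gamma_ofReal] using hr.hasDerivAt.ofReal_comp
  rw [Complex.digamma_def, logDeriv_apply, digamma, logDeriv_apply, h1.unique h2,
    Complex.Gamma_ofReal]
  push_cast
  rfl

/-- The weights `π_d(n) = (d choose n) / (2^d - 1)`. -/
def mixWeight (d n : ℕ) : ℝ := (d.choose n : ℝ) / ((2 : ℝ) ^ d - 1)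

/-- `μ₀(σ) = log σ + (1/2) ∑_{n=1}^d π_d(n) [log 2 + ψ₀(n/2)]`. -/
def meanRate (d : ℕ) (σ : ℝ) : ℝ :=
  Real.log σ +
    (1 / 2) * ∑ n ∈ Finset.Icc 1 d, mixWeight d n * (Real.log 2 + digamma ((n : ℝ) / 2))

/-- `s₀² = (1/4) ∑_{n=1}^d π_d(n) (ψ₁(n/2) + [log 2 + ψ₀(n/2)]²)
      - (1/4) (∑_{n=1}^d π_d(n) [log 2 + ψ₀(n/2)])²`. -/
def limitVariance (d : ℕ) : ℝ :=
  (1 / 4) * ∑ n ∈ Finset.Icc 1 d, mixWeight d n *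
      (trigamma ((n : ℝ) / 2) + (Real.log 2 + digamma ((n : ℝ) / 2)) ^ 2)
    - (1 / 4) *
      (∑ n ∈ Finset.Icc 1 d, mixWeight d n * (Real.log 2 + digamma ((n : ℝ) / 2))) ^ 2

end

end GaussianNet

namespace GaussianNet

/-! For a fixed nonzero input x, the vector W x / (σ‖x‖) has independent standard Gaussian
coordinates. As ReLU is positively homogeneous, the next layer has norm σ‖x‖√S with S = ∑
relu(Y_i)², and the law of S does not depend on x. Each coordinate survives with probability 1/2, so
S is a binomial mixture of chi-squared laws (`map_sum_relu_sq`). The term n = 0 is the event that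
the layer dies; removing it and renormalising gives the weights π_d(n) and the law `stepLaw` of one
increment of the log-norm.

Hence, on the event of survival, each layer convolves the law of the log-norm with `aliveProb d •
stepLaw d σ` (`aliveLogLaw_layer`). After k layers the scalar factor is exactly the survival
probability, so the conditional law is the law of a random walk with k independent steps
(`condLogNormLaw_output`).

The mean and variance of a step come from the cumulant generating function of log X for a Gamma
variable X, whose derivatives are digamma and trigamma. Steps have exponential moments, so Chernoff
bounds and Borel–Cantelli give almost sure convergence from the marginals alone, whatever the
coupling. The central limit theorem also concerns marginals only and transfers from the walk. -/

/-- Two finite measures on `ℝ` whose moment generating functions are finite and agree on a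
half-line containing a neighbourhood of `0` are equal. -/
theorem ext_of_mgf_eq_of_lt {μ ν : Measure ℝ} [IsFiniteMeasure μ] [IsFiniteMeasure ν] {r : ℝ}
    (hr : 0 < r) (hμ : ∀ t < r, Integrable (fun x => Real.exp (t * id x)) μ)
    (hν : ∀ t < r, Integrable (fun x => Real.exp (t * id x)) ν)
    (h : ∀ t < r, mgf id μ t = mgf id ν t) : μ = ν := by
  set U : Set ℂ := {z | z.re < r} with hU
  have hUo : IsPreconnected U := (convex_halfSpace_re_lt r).isPreconnected
  have hsub {ρ : Measure ℝ} (hρ : ∀ t < r, Integrable (fun x => Real.exp (t * id x)) ρ) :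
      U ⊆ {z | z.re ∈ interior (integrableExpSet id ρ)} := fun z hz =>
    mem_interior.2 ⟨Set.Iio r, fun t ht => hρ t ht, isOpen_Iio, hz⟩
  -- Identity theorem on the half-plane: the complex transforms agree on the reals near 0, which
  -- accumulate at 0. The imaginary axis, where they are the characteristic functions, lies in the
  -- half-plane because r > 0.
  have hEq : Set.EqOn (complexMGF id μ) (complexMGF id ν) U := by
    refine (analyticOnNhd_complexMGF.mono (hsub hμ)).eqOn_of_preconnected_of_frequently_eq
      (analyticOnNhd_complexMGF.mono (hsub hν)) hUo (z₀ := 0) (by simpa [hU] using hr) ?_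
    have h1 : Tendsto (fun t : ℝ => (t : ℂ)) (𝓝[≠] 0) (𝓝[≠] (0 : ℂ)) := by
      refine tendsto_nhdsWithin_iff.2 ⟨?_, ?_⟩
      · exact (Complex.continuous_ofReal.tendsto' 0 0 (by simp)).mono_left nhdsWithin_le_nhds
      · filter_upwards [self_mem_nhdsWithin] with t ht
        simpa using ht
    refine h1.frequently (Eventually.frequently ?_)
    filter_upwards [nhdsWithin_le_nhds (Iio_mem_nhds hr)] with t ht
    rw [complexMGF_ofReal, complexMGF_ofReal, h t ht]
  refine Measure.ext_of_charFun (funext fun t => ?_)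
  rw [← complexMGF_id_mul_I, ← complexMGF_id_mul_I]
  exact hEq (by simpa [hU] using hr)

/-! ### Gamma laws: exponential moments and moments of the logarithm. -/

theorem integral_gammaMeasure {a r : ℝ} (ha : 0 < a) (hr : 0 < r) (f : ℝ → ℝ) :
    ∫ x, f x ∂gammaMeasure a r =
      r ^ a / Real.Gamma a * ∫ x in Set.Ioi 0, f x * (x ^ (a - 1) * Real.exp (-(r * x))) := by
  have hm : Measurable (gammaPDF a r) := (measurable_gammaPDFReal a r).ennreal_ofReal
  rw [gammaMeasure, integral_withDensity_eq_integral_toReal_smul hm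
    (Eventually.of_forall fun _ => ENNReal.ofReal_lt_top), ← integral_Ici_eq_integral_Ioi,
    ← integral_const_mul, ← integral_indicator measurableSet_Ici]
  congr 1 with x
  rw [gammaPDF, ENNReal.toReal_ofReal (gammaPDFReal_nonneg ha hr x)]
  simp only [gammaPDFReal, Set.indicator, Set.mem_Ici, smul_eq_mul]
  split_ifs <;> ring

theorem gammaMeasure_Iic_zero {a r : ℝ} : gammaMeasure a r (Set.Iic 0) = 0 := by
  rw [gammaMeasure, withDensity_apply _ measurableSet_Iic, ← setLIntegral_congr Iio_ae_eq_Iic]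
  exact lintegral_gammaPDF_of_nonpos le_rfl

theorem mgf_id_gammaMeasure {a r t : ℝ} (ha : 0 < a) (hr : 0 < r) (ht : t < r) :
    mgf id (gammaMeasure a r) t = (r / (r - t)) ^ a := by
  have hrt : 0 < r - t := sub_pos.2 ht
  rw [mgf, integral_gammaMeasure ha hr]
  have : ∀ x : ℝ, Real.exp (t * id x) * (x ^ (a - 1) * Real.exp (-(r * x))) =
      x ^ (a - 1) * Real.exp (-((r - t) * x)) := fun x => by
    rw [mul_left_comm, ← Real.exp_add, id]
    ring_nf
  simp_rw [this]
  rw [Real.integral_rpow_mul_exp_neg_mul_Ioi ha hrt, Real.div_rpow hr.le hrt.le,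
    Real.div_rpow zero_le_one hrt.le, Real.one_rpow]
  have := (Real.Gamma_pos_of_pos ha).ne'
  field_simp

theorem integrable_exp_mul_id_gammaMeasure {a r t : ℝ} (ha : 0 < a) (hr : 0 < r) (ht : t < r) :
    Integrable (fun x => Real.exp (t * id x)) (gammaMeasure a r) := by
  -- A nonintegrable function has Bochner integral 0, so the nonzero closed form already forces
  -- integrability.
  refine Integrable.of_integral_ne_zero ?_
  have h := mgf_id_gammaMeasure ha hr ht
  rw [mgf] at h
  rw [h]
  have : 0 < r - t := sub_pos.2 ht
  positivity

/-- Since exp(t log x) = x^t for x > 0, the factor only shifts the shape parameter from a to a + t,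
and Euler's integral applies as long as a + t > 0. -/
theorem mgf_log_gammaMeasure {a r t : ℝ} (ha : 0 < a) (hr : 0 < r) (ht : -a < t) :
    mgf Real.log (gammaMeasure a r) t = r ^ (-t) * Real.Gamma (a + t) / Real.Gamma a := by
  have hat : 0 < a + t := by linarith
  rw [mgf, integral_gammaMeasure ha hr]
  have : ∀ x ∈ Set.Ioi (0 : ℝ),
      Real.exp (t * Real.log x) * (x ^ (a - 1) * Real.exp (-(r * x))) =
      x ^ (a + t - 1) * Real.exp (-(r * x)) := fun x hx => by
    rw [mul_comm t, ← Real.rpow_def_of_pos hx, ← mul_assoc, ← Real.rpow_add hx]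
    ring_nf
  rw [setIntegral_congr_fun measurableSet_Ioi this, Real.integral_rpow_mul_exp_neg_mul_Ioi hat hr,
    Real.div_rpow zero_le_one hr.le, Real.one_rpow, Real.rpow_add hr, Real.rpow_neg hr.le]
  have := (Real.Gamma_pos_of_pos ha).ne'
  field_simp

theorem integrable_exp_mul_log_gammaMeasure {a r t : ℝ} (ha : 0 < a) (hr : 0 < r) (ht : -a < t) :
    Integrable (fun x => Real.exp (t * Real.log x)) (gammaMeasure a r) := by
  refine Integrable.of_integral_ne_zero ?_
  have h := mgf_log_gammaMeasure ha hr ht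
  rw [mgf] at h
  rw [h]
  have : 0 < Real.Gamma (a + t) := Real.Gamma_pos_of_pos (by linarith)
  have : 0 < Real.Gamma a := Real.Gamma_pos_of_pos ha
  positivity

theorem mem_interior_integrableExpSet_log_gammaMeasure {a r t : ℝ} (ha : 0 < a) (hr : 0 < r)
    (ht : -a < t) : t ∈ interior (integrableExpSet Real.log (gammaMeasure a r)) :=
  mem_interior.2 ⟨Set.Ioi (-a), fun _ h => integrable_exp_mul_log_gammaMeasure ha hr h,
    isOpen_Ioi, ht⟩

theorem hasDerivAt_log_Gamma {x : ℝ} (hx : 0 < x) :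
    HasDerivAt (fun y => Real.log (Real.Gamma y)) (digamma x) x :=
  (Real.differentiableAt_Gamma fun m h => by
    have : (0 : ℝ) ≤ m := m.cast_nonneg
    linarith).hasDerivAt.log (Real.Gamma_pos_of_pos hx).ne'

theorem cgf_log_gammaMeasure {a r t : ℝ} (ha : 0 < a) (hr : 0 < r) (ht : -a < t) :
    cgf Real.log (gammaMeasure a r) t =
      -t * Real.log r + Real.log (Real.Gamma (a + t)) - Real.log (Real.Gamma a) := by
  have h1 : 0 < Real.Gamma (a + t) := Real.Gamma_pos_of_pos (by linarith)
  have h2 : 0 < Real.Gamma a := Real.Gamma_pos_of_pos ha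
  rw [cgf, mgf_log_gammaMeasure ha hr ht, Real.log_div (by positivity) h2.ne',
    Real.log_mul (by positivity) h1.ne', Real.log_rpow hr]

theorem deriv_cgf_log_gammaMeasure {a r t : ℝ} (ha : 0 < a) (hr : 0 < r) (ht : -a < t) :
    deriv (cgf Real.log (gammaMeasure a r)) t = digamma (a + t) - Real.log r := by
  have hev : cgf Real.log (gammaMeasure a r) =ᶠ[𝓝 t] fun t =>
      -t * Real.log r + Real.log (Real.Gamma (a + t)) - Real.log (Real.Gamma a) := by
    filter_upwards [Ioi_mem_nhds ht] with s hs using cgf_log_gammaMeasure ha hr hs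
  rw [hev.deriv_eq]
  have h1 : HasDerivAt (fun t => Real.log (Real.Gamma (a + t))) (digamma (a + t)) t :=
    (hasDerivAt_log_Gamma (by linarith : 0 < a + t)).comp_const_add a t
  have h2 := (((hasDerivAt_neg t).mul_const (Real.log r)).add h1).sub_const
    (Real.log (Real.Gamma a))
  refine h2.deriv.trans ?_
  ring

theorem integral_log_gammaMeasure {a r : ℝ} (ha : 0 < a) (hr : 0 < r) :
    ∫ x, Real.log x ∂gammaMeasure a r = digamma a - Real.log r := by
  have := isProbabilityMeasure_gammaMeasure ha hr
  have h := deriv_cgf_zero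
    (mem_interior_integrableExpSet_log_gammaMeasure ha hr (neg_neg_of_pos ha))
  rw [deriv_cgf_log_gammaMeasure ha hr (neg_neg_of_pos ha), add_zero] at h
  simpa using h.symm

/-- The second derivative of the cumulant generating function at 0 is the variance of log X, and it
equals the derivative of digamma at a. -/
theorem integral_log_sq_gammaMeasure {a r : ℝ} (ha : 0 < a) (hr : 0 < r) :
    ∫ x, Real.log x ^ 2 ∂gammaMeasure a r = trigamma a + (digamma a - Real.log r) ^ 2 := by
  have := isProbabilityMeasure_gammaMeasure ha hr
  have h0 := neg_neg_of_pos ha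
  have h := iteratedDeriv_two_cgf (mem_interior_integrableExpSet_log_gammaMeasure ha hr h0)
  have hev : deriv (cgf Real.log (gammaMeasure a r)) =ᶠ[𝓝 0] fun t =>
      digamma (a + t) - Real.log r := by
    filter_upwards [Ioi_mem_nhds h0] with s hs using deriv_cgf_log_gammaMeasure ha hr hs
  rw [iteratedDeriv_succ, iteratedDeriv_one, hev.deriv_eq, deriv_sub_const,
    deriv_comp_const_add, deriv_cgf_log_gammaMeasure ha hr h0] at h
  simp only [add_zero, zero_mul, Real.exp_zero, mul_one, mgf_zero, div_one] at h
  rw [trigamma, h]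
  ring

/-! ### Sums of squared rectified Gaussians. -/

theorem measurable_relu : Measurable relu := measurable_id.max measurable_const

/-- The negative half-line contributes 1/2; the positive one contributes half the generating
function of a chi-squared variable with one degree of freedom. The value is thus that of a fair
mixture of δ₀ and χ²₁. -/
theorem integrable_and_integral_exp_relu_sq {t : ℝ} (ht : t < 1 / 2) :
    Integrable (fun x => Real.exp (t * relu x ^ 2)) (gaussianReal 0 1) ∧
    ∫ x, Real.exp (t * relu x ^ 2) ∂gaussianReal 0 1 =
      (√((1 / 2) / (1 / 2 - t)) + 1) / 2 := by
  have hb : 0 < 1 / 2 - t := sub_pos.2 ht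
  have e1 : ∀ x ∈ Set.Ioi (0 : ℝ), gaussianPDFReal 0 1 x • Real.exp (t * relu x ^ 2) =
      (√(2 * Real.pi))⁻¹ * Real.exp (-(1 / 2 - t) * x ^ 2) := fun x hx => by
    rw [relu, max_eq_left (le_of_lt hx), gaussianPDFReal, smul_eq_mul, mul_assoc, ← Real.exp_add]
    simp only [NNReal.coe_one]
    ring_nf
  have e2 : ∀ x ∈ Set.Iic (0 : ℝ), gaussianPDFReal 0 1 x • Real.exp (t * relu x ^ 2) =
      (√(2 * Real.pi))⁻¹ * Real.exp (-(1 / 2) * x ^ 2) := fun x hx => by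
    rw [relu, max_eq_right hx, gaussianPDFReal, smul_eq_mul, mul_assoc, ← Real.exp_add]
    simp only [NNReal.coe_one]
    ring_nf
  have i1 : IntegrableOn (fun x => gaussianPDFReal 0 1 x • Real.exp (t * relu x ^ 2))
      (Set.Ioi 0) := (integrableOn_congr_fun e1 measurableSet_Ioi).2
    ((integrable_exp_neg_mul_sq hb).const_mul _).integrableOn
  have i2 : IntegrableOn (fun x => gaussianPDFReal 0 1 x • Real.exp (t * relu x ^ 2))
      (Set.Iic 0) := (integrableOn_congr_fun e2 measurableSet_Iic).2
    ((integrable_exp_neg_mul_sq one_half_pos).const_mul _).integrableOn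
  have v : ∫ x, Real.exp (t * relu x ^ 2) ∂gaussianReal 0 1 =
      (√((1 / 2) / (1 / 2 - t)) + 1) / 2 := by
    rw [integral_gaussianReal_eq_integral_smul one_ne_zero,
      ← intervalIntegral.integral_Iic_add_Ioi i2 i1, setIntegral_congr_fun measurableSet_Ioi e1,
      setIntegral_congr_fun measurableSet_Iic e2, integral_const_mul, integral_const_mul,
      integral_gaussian_Ioi]
    have hneg : ∫ x in Set.Iic (0 : ℝ), Real.exp (-(1 / 2) * x ^ 2) =
        ∫ x in Set.Ioi (0 : ℝ), Real.exp (-(1 / 2) * x ^ 2) := by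
      have := integral_comp_neg_Iic (0 : ℝ) fun x => Real.exp (-(1 / 2) * x ^ 2)
      simpa using this
    have hpi : √(2 * Real.pi) ≠ 0 := by positivity
    have h2 : Real.pi / (1 / 2) = 2 * Real.pi := by ring
    have h3 : Real.pi / (1 / 2 - t) = 2 * Real.pi * ((1 / 2) / (1 / 2 - t)) := by ring
    rw [hneg, integral_gaussian_Ioi, h2, h3, Real.sqrt_mul (by positivity) ((1 / 2) / _)]
    generalize √(2 * Real.pi) = c at hpi
    field_simp
    ring
  refine ⟨Integrable.of_integral_ne_zero ?_, v⟩
  rw [v]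
  positivity

/-- The law of `∑ i, relu (Y i) ^ 2` for independent standard Gaussian `Y i`, `i < d`: a binomial
mixture of chi-squared laws. -/
noncomputable def reluSqLaw (d : ℕ) : Measure ℝ :=
  ∑ n ∈ Finset.range (d + 1), ENNReal.ofReal ((d.choose n : ℝ) / 2 ^ d) •
    (if n = 0 then Measure.dirac 0 else gammaMeasure ((n : ℝ) / 2) (1 / 2))

theorem isProbabilityMeasure_reluSqLaw_component (n : ℕ) : IsProbabilityMeasure
    (if n = 0 then Measure.dirac 0 else gammaMeasure ((n : ℝ) / 2) (1 / 2) : Measure ℝ) := by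
  split_ifs with h
  · infer_instance
  · have : 0 < n := Nat.pos_of_ne_zero h
    exact isProbabilityMeasure_gammaMeasure (by positivity) one_half_pos

instance (d : ℕ) : IsFiniteMeasure (reluSqLaw d) := by
  have := isProbabilityMeasure_reluSqLaw_component
  refine ⟨?_⟩
  simp only [reluSqLaw, Measure.coe_finsetSum, Finset.sum_apply, Measure.smul_apply, measure_univ,
    smul_eq_mul, mul_one]
  exact ENNReal.sum_lt_top.2 fun n _ => ENNReal.ofReal_lt_top

theorem integrable_and_integral_exp_reluSqLaw_component (n : ℕ) {t : ℝ} (ht : t < 1 / 2) :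
    Integrable (fun x => Real.exp (t * id x))
      (if n = 0 then Measure.dirac 0 else gammaMeasure ((n : ℝ) / 2) (1 / 2)) ∧
    ∫ x, Real.exp (t * id x)
      ∂(if n = 0 then Measure.dirac 0 else gammaMeasure ((n : ℝ) / 2) (1 / 2)) =
      √((1 / 2) / (1 / 2 - t)) ^ n := by
  split_ifs with h
  · subst h
    exact ⟨integrable_dirac (by simp), by simp⟩
  · have hn : 0 < n := Nat.pos_of_ne_zero h
    refine ⟨integrable_exp_mul_id_gammaMeasure (by positivity) one_half_pos ht, ?_⟩
    rw [← mgf, mgf_id_gammaMeasure (by positivity) one_half_pos ht, Real.sqrt_eq_rpow,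
      ← Real.rpow_mul_natCast (div_nonneg (by norm_num) (sub_pos.2 ht).le)]
    ring_nf

theorem integrable_exp_reluSqLaw (d : ℕ) {t : ℝ} (ht : t < 1 / 2) :
    Integrable (fun x => Real.exp (t * id x)) (reluSqLaw d) :=
  integrable_finsetSum_measure.2 fun n _ =>
    (integrable_and_integral_exp_reluSqLaw_component n ht).1.smul_measure ENNReal.ofReal_ne_top

/-- The binomial theorem: expanding the d-th power of the one-coordinate generating function
produces the weights C(d,n)/2^d. -/
theorem mgf_reluSqLaw (d : ℕ) {t : ℝ} (ht : t < 1 / 2) :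
    mgf id (reluSqLaw d) t = ((√((1 / 2) / (1 / 2 - t)) + 1) / 2) ^ d := by
  rw [mgf, reluSqLaw, integral_finsetSum_measure fun n _ =>
    (integrable_and_integral_exp_reluSqLaw_component n ht).1.smul_measure
      ENNReal.ofReal_ne_top, div_pow, add_pow, Finset.sum_div]
  refine Finset.sum_congr rfl fun n _ => ?_
  rw [integral_smul_measure, (integrable_and_integral_exp_reluSqLaw_component n ht).2,
    ENNReal.toReal_ofReal (by positivity), one_pow, smul_eq_mul]
  ring

theorem map_sum_relu_sq {Ω : Type*} [MeasurableSpace Ω] {P : Measure Ω} {d : ℕ}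
    {Y : Fin d → Ω → ℝ} (hY : ∀ i, Measurable (Y i)) (hind : iIndepFun Y P)
    (hlaw : ∀ i, P.map (Y i) = gaussianReal 0 1) :
    P.map (fun ω => ∑ i, relu (Y i ω) ^ 2) = reluSqLaw d := by
  have := hind.isProbabilityMeasure
  have hf : Measurable fun x => relu x ^ 2 := measurable_relu.pow_const 2
  have hX : ∀ i, Measurable fun ω => relu (Y i ω) ^ 2 := fun i => hf.comp (hY i)
  have hXind : iIndepFun (fun i ω => relu (Y i ω) ^ 2) P := hind.comp (fun _ x => relu x ^ 2)
    fun _ => hf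
  have hint : ∀ t < (1 / 2 : ℝ), ∀ i,
      Integrable (fun ω => Real.exp (t * relu (Y i ω) ^ 2)) P := fun t ht i => by
    have := (integrable_and_integral_exp_relu_sq ht).1
    rw [← hlaw i] at this
    exact this.comp_measurable (hY i)
  have hsum : (fun ω => ∑ i, relu (Y i ω) ^ 2) = ∑ i, fun ω => relu (Y i ω) ^ 2 := by
    ext ω
    simp
  have hmS : Measurable (∑ i, fun ω => relu (Y i ω) ^ 2) :=
    hsum ▸ Finset.measurable_sum _ fun i _ => hX i
  rw [hsum]
  refine ext_of_mgf_eq_of_lt one_half_pos (fun t ht => ?_)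
    (fun t ht => integrable_exp_reluSqLaw d ht) fun t ht => ?_
  · rw [integrable_map_measure (by fun_prop) hmS.aemeasurable]
    exact hXind.integrable_exp_mul_sum hX fun i _ => hint t ht i
  · rw [mgf_id_map hmS.aemeasurable, hXind.mgf_sum hX, mgf_reluSqLaw d ht]
    have : ∀ i ∈ Finset.univ, mgf (fun ω => relu (Y i ω) ^ 2) P t =
        (√((1 / 2) / (1 / 2 - t)) + 1) / 2 := fun i _ => by
      rw [← (integrable_and_integral_exp_relu_sq ht).2, ← hlaw i, integral_map (hY i).aemeasurable]
      · rfl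
      · exact (hf.const_mul t).exp.aestronglyMeasurable
    rw [Finset.prod_congr rfl this, Finset.prod_const, Finset.card_univ, Fintype.card_fin]

/-! ### The increment law: moments and relation to survival. -/

/-- The law of `log (‖x⁽ᵏ⁺¹⁾‖ / ‖x⁽ᵏ⁾‖)` given `x⁽ᵏ⁺¹⁾ ≠ 0`. -/
noncomputable def stepLaw (d : ℕ) (σ : ℝ) : Measure ℝ :=
  ∑ n ∈ Finset.Icc 1 d, ENNReal.ofReal (mixWeight d n) •
    (gammaMeasure ((n : ℝ) / 2) (1 / 2)).map fun x => Real.log σ + Real.log x / 2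

theorem one_lt_two_pow_real {d : ℕ} (hd : d ≠ 0) : (1 : ℝ) < 2 ^ d :=
  one_lt_pow₀ one_lt_two hd

theorem mixWeight_nonneg (d n : ℕ) : 0 ≤ mixWeight d n :=
  div_nonneg (Nat.cast_nonneg _) (sub_nonneg.2 (one_le_pow₀ one_le_two))

theorem sum_mixWeight {d : ℕ} (hd : d ≠ 0) : ∑ n ∈ Finset.Icc 1 d, mixWeight d n = 1 := by
  have h : ∑ n ∈ Finset.Icc 1 d, (d.choose n : ℝ) = 2 ^ d - 1 := by
    have := Nat.sum_range_choose d
    rw [Finset.range_eq_Ico, Finset.sum_eq_sum_Ico_succ_bot (Nat.succ_pos d)] at this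
    have h2 : Finset.Ico (0 + 1) (d + 1) = Finset.Icc 1 d := by
      ext
      simp only [Finset.mem_Ico, Finset.mem_Icc]
      omega
    rw [h2, Nat.choose_zero_right] at this
    rw [eq_sub_iff_add_eq, add_comm]
    exact_mod_cast this
  simp only [mixWeight]
  rw [← Finset.sum_div, h, div_self (sub_pos.2 (one_lt_two_pow_real hd)).ne']

theorem measurable_add_log_div_two (c : ℝ) : Measurable fun x : ℝ => c + Real.log x / 2 :=
  (Real.measurable_log.div_const 2).const_add c

theorem isProbabilityMeasure_stepLaw {d : ℕ} (hd : d ≠ 0) (σ : ℝ) :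
    IsProbabilityMeasure (stepLaw d σ) := by
  refine ⟨?_⟩
  have h : ∀ n ∈ Finset.Icc 1 d, (ENNReal.ofReal (mixWeight d n) •
      (gammaMeasure ((n : ℝ) / 2) (1 / 2)).map fun x => Real.log σ + Real.log x / 2) Set.univ =
      ENNReal.ofReal (mixWeight d n) := fun n hn => by
    have hn : 0 < n := (Finset.mem_Icc.1 hn).1
    have := isProbabilityMeasure_gammaMeasure (a := (n : ℝ) / 2) (by positivity) one_half_pos
    rw [Measure.smul_apply, Measure.map_apply (measurable_add_log_div_two _) MeasurableSet.univ,
      Set.preimage_univ, measure_univ, smul_eq_mul, mul_one]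
  rw [stepLaw, Measure.coe_finsetSum, Finset.sum_apply, Finset.sum_congr rfl h,
    ← ENNReal.ofReal_sum_of_nonneg fun n _ => mixWeight_nonneg d n, sum_mixWeight hd,
    ENNReal.ofReal_one]

theorem integrable_stepLaw {d : ℕ} {σ : ℝ} {f : ℝ → ℝ} (hf : Measurable f)
    (h : ∀ n ∈ Finset.Icc 1 d, Integrable (fun x => f (Real.log σ + Real.log x / 2))
      (gammaMeasure ((n : ℝ) / 2) (1 / 2))) : Integrable f (stepLaw d σ) :=
  integrable_finsetSum_measure.2 fun n hn =>
    ((integrable_map_measure hf.aestronglyMeasurable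
      (measurable_add_log_div_two _).aemeasurable).2 (h n hn)).smul_measure ENNReal.ofReal_ne_top

theorem integral_stepLaw {d : ℕ} {σ : ℝ} {f : ℝ → ℝ} (hf : Measurable f)
    (h : ∀ n ∈ Finset.Icc 1 d, Integrable (fun x => f (Real.log σ + Real.log x / 2))
      (gammaMeasure ((n : ℝ) / 2) (1 / 2))) :
    ∫ x, f x ∂stepLaw d σ = ∑ n ∈ Finset.Icc 1 d, mixWeight d n *
      ∫ x, f (Real.log σ + Real.log x / 2) ∂gammaMeasure ((n : ℝ) / 2) (1 / 2) := by
  rw [stepLaw, integral_finsetSum_measure fun n hn => ((integrable_map_measure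
    hf.aestronglyMeasurable (measurable_add_log_div_two _).aemeasurable).2
    (h n hn)).smul_measure ENNReal.ofReal_ne_top]
  refine Finset.sum_congr rfl fun n _ => ?_
  rw [integral_smul_measure, integral_map (measurable_add_log_div_two _).aemeasurable
    hf.aestronglyMeasurable, ENNReal.toReal_ofReal (mixWeight_nonneg d n), smul_eq_mul]

/-- The bound -1 comes from n = 1: halving the logarithm turns t into t/2, which must exceed minus
the smallest shape parameter, -1/2. -/
theorem integrable_exp_stepLaw (d : ℕ) (σ : ℝ) {t : ℝ} (ht : -1 < t) :
    Integrable (fun x => Real.exp (t * x)) (stepLaw d σ) := by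
  refine integrable_stepLaw (by fun_prop) fun n hn => ?_
  have hn : (1 : ℝ) ≤ n := by exact_mod_cast (Finset.mem_Icc.1 hn).1
  have h := (integrable_exp_mul_log_gammaMeasure (a := (n : ℝ) / 2) (r := 1 / 2) (t := t / 2)
    (by positivity) one_half_pos (by linarith)).const_mul (Real.exp (t * Real.log σ))
  refine h.congr (Eventually.of_forall fun x => ?_)
  simp only
  rw [← Real.exp_add]
  ring_nf

theorem zero_mem_interior_integrableExpSet_stepLaw (d : ℕ) (σ : ℝ) :
    0 ∈ interior (integrableExpSet id (stepLaw d σ)) :=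
  mem_interior.2 ⟨Set.Ioi (-1), fun _ h => integrable_exp_stepLaw d σ h, isOpen_Ioi,
    by simp⟩

theorem integrable_log_pow_gammaMeasure {a r : ℝ} (ha : 0 < a) (hr : 0 < r) (k : ℕ) :
    Integrable (fun x => Real.log x ^ k) (gammaMeasure a r) :=
  integrable_pow_of_mem_interior_integrableExpSet
    (mem_interior_integrableExpSet_log_gammaMeasure ha hr (neg_neg_of_pos ha)) k

theorem integral_id_stepLaw {d : ℕ} (hd : d ≠ 0) (σ : ℝ) :
    ∫ x, x ∂stepLaw d σ = meanRate d σ := by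
  have key : ∀ n ∈ Finset.Icc 1 d,
      Integrable (fun x => Real.log σ + Real.log x / 2) (gammaMeasure ((n : ℝ) / 2) (1 / 2)) ∧
      mixWeight d n * ∫ x, (Real.log σ + Real.log x / 2) ∂gammaMeasure ((n : ℝ) / 2) (1 / 2) =
        mixWeight d n * Real.log σ +
          1 / 2 * (mixWeight d n * (Real.log 2 + digamma ((n : ℝ) / 2))) := fun n hn => by
    have hn : 0 < n := (Finset.mem_Icc.1 hn).1
    have ha : 0 < (n : ℝ) / 2 := by positivity
    have := isProbabilityMeasure_gammaMeasure ha one_half_pos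
    have i1 : Integrable Real.log (gammaMeasure ((n : ℝ) / 2) (1 / 2)) := by
      simpa using integrable_log_pow_gammaMeasure ha one_half_pos 1
    refine ⟨(integrable_const _).add (i1.div_const 2), ?_⟩
    rw [integral_add (integrable_const _) (i1.div_const 2), integral_div,
      integral_log_gammaMeasure ha one_half_pos, integral_const, probReal_univ, one_smul,
      one_div, Real.log_inv]
    ring
  rw [integral_stepLaw (f := fun x => x) measurable_id fun n hn => (key n hn).1,
    Finset.sum_congr rfl fun n hn => (key n hn).2, Finset.sum_add_distrib, ← Finset.sum_mul,
    sum_mixWeight hd, ← Finset.mul_sum, meanRate, one_mul]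

theorem variance_id_stepLaw {d : ℕ} (hd : d ≠ 0) (σ : ℝ) :
    Var[id; stepLaw d σ] = limitVariance d := by
  have := isProbabilityMeasure_stepLaw hd σ
  have key : ∀ n ∈ Finset.Icc 1 d,
      Integrable (fun x => (Real.log σ + Real.log x / 2) ^ 2)
        (gammaMeasure ((n : ℝ) / 2) (1 / 2)) ∧
      mixWeight d n *
          ∫ x, (Real.log σ + Real.log x / 2) ^ 2 ∂gammaMeasure ((n : ℝ) / 2) (1 / 2) =
        mixWeight d n * Real.log σ ^ 2 +
          Real.log σ * (mixWeight d n * (Real.log 2 + digamma ((n : ℝ) / 2))) +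
          1 / 4 * (mixWeight d n * (trigamma ((n : ℝ) / 2) +
            (Real.log 2 + digamma ((n : ℝ) / 2)) ^ 2)) := fun n hn => by
    have hn : 0 < n := (Finset.mem_Icc.1 hn).1
    have ha : 0 < (n : ℝ) / 2 := by positivity
    have := isProbabilityMeasure_gammaMeasure ha one_half_pos
    have i1 : Integrable Real.log (gammaMeasure ((n : ℝ) / 2) (1 / 2)) := by
      simpa using integrable_log_pow_gammaMeasure ha one_half_pos 1
    have i2 := integrable_log_pow_gammaMeasure ha one_half_pos 2
    have e : (fun x => (Real.log σ + Real.log x / 2) ^ 2) = fun x =>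
        (Real.log σ ^ 2 + Real.log σ * Real.log x) + 1 / 4 * Real.log x ^ 2 := by
      ext x
      ring
    have i3 : Integrable (fun x => Real.log σ ^ 2 + Real.log σ * Real.log x)
        (gammaMeasure ((n : ℝ) / 2) (1 / 2)) := (integrable_const _).add (i1.const_mul _)
    rw [e]
    refine ⟨i3.add (i2.const_mul _), ?_⟩
    rw [integral_add i3 (i2.const_mul _), integral_add (integrable_const _) (i1.const_mul _),
      integral_const_mul, integral_const_mul, integral_log_gammaMeasure ha one_half_pos,
      integral_log_sq_gammaMeasure ha one_half_pos, integral_const, probReal_univ, one_smul,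
      one_div 2, Real.log_inv]
    ring
  have hL : MemLp id 2 (stepLaw d σ) :=
    memLp_of_mem_interior_integrableExpSet (zero_mem_interior_integrableExpSet_stepLaw d σ) 2
  rw [variance_eq_sub hL]
  have h2 : ∫ x, (id ^ 2 : ℝ → ℝ) x ∂stepLaw d σ = ∑ n ∈ Finset.Icc 1 d, mixWeight d n *
      ∫ x, (Real.log σ + Real.log x / 2) ^ 2 ∂gammaMeasure ((n : ℝ) / 2) (1 / 2) :=
    integral_stepLaw (f := fun x => x ^ 2) (by fun_prop) fun n hn => (key n hn).1
  have h1 : ∫ x, id x ∂stepLaw d σ = meanRate d σ := integral_id_stepLaw hd σ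
  rw [h1, h2, Finset.sum_congr rfl fun n hn => (key n hn).2, Finset.sum_add_distrib,
    Finset.sum_add_distrib, ← Finset.sum_mul, sum_mixWeight hd, ← Finset.mul_sum,
    ← Finset.mul_sum, meanRate, limitVariance]
  ring

theorem limitVariance_nonneg {d : ℕ} (hd : d ≠ 0) : 0 ≤ limitVariance d := by
  rw [← variance_id_stepLaw hd 1]
  exact variance_nonneg _ _

/-- The probability that one layer does not kill its input. -/
noncomputable def aliveProb (d : ℕ) : ENNReal := ENNReal.ofReal ((2 ^ d - 1) / 2 ^ d)

theorem aliveProb_ne_zero {d : ℕ} (hd : d ≠ 0) : aliveProb d ≠ 0 := by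
  have := one_lt_two_pow_real hd
  exact (ENNReal.ofReal_pos.2 (div_pos (by linarith) (by positivity))).ne'

/-- Deleting 0 kills exactly the Dirac component, since Gamma laws do not charge 0; the other
weights factor as C(d,n)/2^d = ((2^d - 1)/2^d) π_d(n). -/
theorem restrict_reluSqLaw_map {d : ℕ} (hd : d ≠ 0) (σ : ℝ) :
    ((reluSqLaw d).restrict {0}ᶜ).map (fun x => Real.log σ + Real.log x / 2) =
      aliveProb d • stepLaw d σ := by
  have h0 : MeasurableSet ({0}ᶜ : Set ℝ) := (measurableSet_singleton 0).compl
  have hm := measurable_add_log_div_two (Real.log σ)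
  ext s hs
  have hs' := hm hs
  rw [Measure.map_apply hm hs, Measure.restrict_apply hs', reluSqLaw, stepLaw,
    Measure.smul_apply, Measure.coe_finsetSum, Finset.sum_apply, Measure.coe_finsetSum,
    Finset.sum_apply, smul_eq_mul, Finset.mul_sum, Finset.range_eq_Ico,
    Finset.sum_eq_sum_Ico_succ_bot (Nat.succ_pos d)]
  have h2 : Finset.Ico (0 + 1) (d + 1) = Finset.Icc 1 d := by
    ext
    simp only [Finset.mem_Ico, Finset.mem_Icc]
    omega
  rw [h2, if_pos rfl, Measure.smul_apply, Measure.dirac_apply' _ (hs'.inter h0),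
    Set.indicator_of_notMem (by simp), smul_zero, zero_add]
  refine Finset.sum_congr rfl fun n hn => ?_
  have hn : n ≠ 0 := Nat.one_le_iff_ne_zero.1 (Finset.mem_Icc.1 hn).1
  rw [if_neg hn, Measure.smul_apply, Measure.smul_apply, Measure.map_apply hm hs, smul_eq_mul,
    smul_eq_mul, ← mul_assoc, aliveProb, ← ENNReal.ofReal_mul (div_nonneg
      (sub_nonneg.2 (one_lt_two_pow_real hd).le) (by positivity))]
  refine congrArg₂ (· * ·) (congrArg _ ?_) ?_
  · rw [mixWeight]
    have : (2 : ℝ) ^ d - 1 ≠ 0 := (sub_pos.2 (one_lt_two_pow_real hd)).ne'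
    field_simp
  · refine measure_inter_conull ?_
    refine measure_mono_null ?_ gammaMeasure_Iic_zero
    intro x hx
    simp_all

/-! ### Gaussian preactivations. -/

theorem charFun_map_linear_combination {Ω ι : Type*} [MeasurableSpace Ω] [Fintype ι]
    {P : Measure Ω} {X : ι → Ω → ℝ} {v : NNReal} (hX : ∀ i, Measurable (X i))
    (hind : iIndepFun X P) (hlaw : ∀ i, P.map (X i) = gaussianReal 0 v) (a : ι → ℝ) (t : ℝ) :
    charFun (P.map fun ω => ∑ i, a i * X i ω) t =
      Complex.exp (-((t ^ 2 * (v * ∑ i, a i ^ 2) / 2 : ℝ) : ℂ)) := by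
  have hind' : iIndepFun (fun i ω => a i * X i ω) P :=
    hind.comp (fun i x => a i * x) fun i => measurable_const_mul (a i)
  rw [hind'.charFun_map_fun_sum_eq_prod fun i => ((hX i).const_mul (a i)).aemeasurable,
    Finset.prod_apply]
  have : ∀ i ∈ Finset.univ, charFun (P.map fun ω => a i * X i ω) t =
      Complex.exp (-((t ^ 2 * (v * a i ^ 2) / 2 : ℝ) : ℂ)) := fun i _ => by
    rw [charFun_map_mul_comp (hX i).aemeasurable, hlaw i, charFun_gaussianReal]
    push_cast
    ring_nf
  rw [Finset.prod_congr rfl this, ← Complex.exp_sum]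
  congr 1
  rw [Finset.sum_neg_distrib, ← Complex.ofReal_sum, Finset.mul_sum, Finset.mul_sum,
    Finset.sum_div]

/-- The normalised preactivations of one layer are independent standard Gaussians. -/
theorem standard_normal_preactivation {Ω : Type*} [MeasurableSpace Ω] {P : Measure Ω} {d : ℕ}
    {σ : ℝ} (hσ : 0 < σ) {M : Fin d × Fin d → Ω → ℝ} (hM : ∀ p, Measurable (M p))
    (hind : iIndepFun M P) (hlaw : ∀ p, P.map (M p) = gaussianReal 0 (Real.toNNReal (σ ^ 2)))
    {x : EuclideanSpace ℝ (Fin d)} (hx : x ≠ 0) :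
    iIndepFun (fun i ω => (σ * ‖x‖)⁻¹ * ∑ j, M (i, j) ω * x j) P ∧
    ∀ i, P.map (fun ω => (σ * ‖x‖)⁻¹ * ∑ j, M (i, j) ω * x j) = gaussianReal 0 1 := by
  have := hind.isProbabilityMeasure
  have hx' : 0 < ‖x‖ := norm_pos_iff.2 hx
  have hsq : ∑ j, x j ^ 2 = ‖x‖ ^ 2 := (EuclideanSpace.real_norm_sq_eq x).symm
  set Y : Fin d → Ω → ℝ := fun i ω => (σ * ‖x‖)⁻¹ * ∑ j, M (i, j) ω * x j with hYdef
  have hY : ∀ i, Measurable (Y i) := fun i =>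
    (Finset.measurable_sum _ fun j _ => (hM (i, j)).mul_const (x j)).const_mul _
  -- A combination of the Y_i is a combination of the entries with coefficients t_i x_j/(σ‖x‖),
  -- whose squares sum to |t|²/σ²; the variance σ² cancels.
  have hcomb (t : Fin d → ℝ) (s : ℝ) : charFun (P.map fun ω => ∑ i, t i * Y i ω) s =
      Complex.exp (-((s ^ 2 * (∑ i, t i ^ 2) / 2 : ℝ) : ℂ)) := by
    have e : (fun ω => ∑ i, t i * Y i ω) =
        fun ω => ∑ p : Fin d × Fin d, (t p.1 * (σ * ‖x‖)⁻¹ * x p.2) * M p ω := by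
      ext ω
      rw [Fintype.sum_prod_type]
      refine Finset.sum_congr rfl fun i _ => ?_
      simp only [hYdef, Finset.mul_sum]
      exact Finset.sum_congr rfl fun j _ => by ring
    rw [e, charFun_map_linear_combination hM hind hlaw]
    congr 4
    rw [Fintype.sum_prod_type, Real.coe_toNNReal _ (sq_nonneg σ)]
    simp only [mul_pow]
    simp only [← Finset.mul_sum, ← Finset.sum_mul, hsq]
    field_simp
  have hmarg (i : Fin d) (s : ℝ) : charFun (P.map (Y i)) s =
      Complex.exp (-((s ^ 2 / 2 : ℝ) : ℂ)) := by
    have := hcomb (Pi.single i 1) s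
    simpa [Pi.single_apply, Finset.sum_ite_eq] using this
  -- Independence is the factorisation of the joint characteristic function, which `hcomb` at s = 1
  -- exhibits as exp(-|t|²/2).
  refine ⟨(iIndepFun_iff_charFun_pi fun i => (hY i).aemeasurable).2 fun t => ?_, fun i => ?_⟩
  · have h1 := hcomb t.ofLp 1
    simp only [hmarg]
    rw [← Complex.exp_sum, Finset.sum_neg_distrib, ← Complex.ofReal_sum, ← Finset.sum_div]
    rw [one_pow, one_mul] at h1
    rw [← h1, charFun_apply, charFun_apply_real, integral_map, integral_map]
    · simp [PiLp.inner_apply]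
    · exact (Finset.measurable_sum _ fun i _ => (hY i).const_mul _).aemeasurable
    · fun_prop
    · exact ((WithLp.measurable_toLp 2 _).comp (measurable_pi_lambda _ hY)).aemeasurable
    · fun_prop
  · refine Measure.ext_of_charFun (funext fun s => ?_)
    rw [hmarg, charFun_gaussianReal]
    congr 1
    push_cast
    simp

/-! ### The effect of one layer on the law of the log-norm. -/

theorem layer_relu_apply {d : ℕ} (W : Matrix (Fin d) (Fin d) ℝ) (x : EuclideanSpace ℝ (Fin d))
    (i : Fin d) : layer relu W 0 x i = relu (∑ j, W i j * x j) := by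
  simp [layer]

theorem relu_mul_of_nonneg {c : ℝ} (hc : 0 ≤ c) (z : ℝ) : relu (c * z) = c * relu z := by
  rw [relu, relu, mul_max_of_nonneg _ _ hc, mul_zero]

theorem norm_layer_relu {d : ℕ} (W : Matrix (Fin d) (Fin d) ℝ) (x : EuclideanSpace ℝ (Fin d))
    {c : ℝ} (hc : 0 < c) :
    ‖layer relu W 0 x‖ = c * √(∑ i, relu (c⁻¹ * ∑ j, W i j * x j) ^ 2) := by
  rw [← Real.sqrt_sq hc.le, ← Real.sqrt_mul (sq_nonneg c), EuclideanSpace.norm_eq]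
  congr 1
  rw [Finset.mul_sum]
  refine Finset.sum_congr rfl fun i _ => ?_
  rw [layer_relu_apply, Real.norm_eq_abs, sq_abs, ← mul_pow, Real.sqrt_sq hc.le,
    ← relu_mul_of_nonneg hc.le, mul_inv_cancel_left₀ hc.ne']

theorem measurable_layer_relu {d : ℕ} :
    Measurable fun p : (Fin d → Fin d → ℝ) × EuclideanSpace ℝ (Fin d) =>
      layer relu (Matrix.of p.1) 0 p.2 := by
  refine (WithLp.measurable_toLp 2 _).comp (measurable_pi_lambda _ fun i => ?_)
  refine measurable_relu.comp ?_
  simp only [Matrix.of_apply, PiLp.zero_apply, add_zero]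
  fun_prop

theorem Measurable.layer_relu {α : Type*} {_ : MeasurableSpace α} {d : ℕ}
    {m : α → Fin d → Fin d → ℝ} {x : α → EuclideanSpace ℝ (Fin d)} (hm : Measurable m)
    (hx : Measurable x) : Measurable fun a => layer relu (Matrix.of (m a)) 0 (x a) :=
  measurable_layer_relu.comp (hm.prodMk hx)

/-- The subprobability law of `log ‖X‖` on the event `X ≠ 0`. -/
noncomputable def aliveLogLaw {Ω : Type*} [MeasurableSpace Ω] (P : Measure Ω) {d : ℕ}
    (X : Ω → EuclideanSpace ℝ (Fin d)) : Measure ℝ :=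
  (P.restrict {ω | X ω ≠ 0}).map fun ω => Real.log ‖X ω‖

theorem aliveLogLaw_layer_const {Ω : Type*} [MeasurableSpace Ω] {P : Measure Ω} {d : ℕ} {σ : ℝ}
    (hσ : 0 < σ) {M : Fin d × Fin d → Ω → ℝ} (hM : ∀ p, Measurable (M p)) (hind : iIndepFun M P)
    (hlaw : ∀ p, P.map (M p) = gaussianReal 0 (Real.toNNReal (σ ^ 2)))
    {x : EuclideanSpace ℝ (Fin d)} (hx : x ≠ 0) :
    aliveLogLaw P (fun ω => layer relu (Matrix.of fun i j => M (i, j) ω) 0 x) =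
      (aliveProb d • stepLaw d σ).map fun y => Real.log ‖x‖ + y := by
  have hd : d ≠ 0 := by
    rintro rfl
    exact hx (Subsingleton.elim _ _)
  have hx' : 0 < ‖x‖ := norm_pos_iff.2 hx
  have hc : 0 < σ * ‖x‖ := mul_pos hσ hx'
  obtain ⟨hYi, hYl⟩ := standard_normal_preactivation hσ hM hind hlaw hx
  set Y : Fin d → Ω → ℝ := fun i ω => (σ * ‖x‖)⁻¹ * ∑ j, M (i, j) ω * x j with hYdef
  have hY : ∀ i, Measurable (Y i) := fun i =>
    (Finset.measurable_sum _ fun j _ => (hM (i, j)).mul_const (x j)).const_mul _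
  set S : Ω → ℝ := fun ω => ∑ i, relu (Y i ω) ^ 2 with hSdef
  have hS : Measurable S :=
    Finset.measurable_sum _ fun i _ => (measurable_relu.comp (hY i)).pow_const 2
  have hS0 : ∀ ω, 0 ≤ S ω := fun ω => Finset.sum_nonneg fun i _ => sq_nonneg _
  have hnorm : ∀ ω, ‖layer relu (Matrix.of fun i j => M (i, j) ω) 0 x‖ = σ * ‖x‖ * √(S ω) :=
    fun ω => norm_layer_relu _ x hc
  have h0 : MeasurableSet ({0}ᶜ : Set ℝ) := (measurableSet_singleton 0).compl
  have hset : {ω | layer relu (Matrix.of fun i j => M (i, j) ω) 0 x ≠ 0} = S ⁻¹' {0}ᶜ := by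
    ext ω
    have : layer relu (Matrix.of fun i j => M (i, j) ω) 0 x = 0 ↔ S ω = 0 := by
      rw [← norm_eq_zero, hnorm, mul_eq_zero, Real.sqrt_eq_zero (hS0 ω)]
      exact or_iff_right hc.ne'
    exact not_congr this
  have hL := measurable_add_log_div_two (Real.log σ)
  rw [aliveLogLaw, hset, ← restrict_reluSqLaw_map hd σ, ← map_sum_relu_sq hY hYi hYl,
    Measure.restrict_map hS h0, Measure.map_map hL hS, Measure.map_map (by fun_prop)
    (hL.comp hS)]
  -- The logarithm splits into a sum only where S ≠ 0, so equality is needed almost everywhere for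
  -- the restricted measure only.
  refine Measure.map_congr ?_
  filter_upwards [ae_restrict_mem (hS h0)] with ω hω
  have hSp : 0 < S ω := lt_of_le_of_ne (hS0 ω) (Ne.symm hω)
  rw [hnorm, Real.log_mul hc.ne' (Real.sqrt_pos.2 hSp).ne', Real.log_mul hσ.ne' hx'.ne',
    Real.log_sqrt hSp.le]
  simp only [Function.comp]
  ring

/-- By Fubini the independent input may be frozen at x. For x ≠ 0 the increment law does not depend
on x, which yields a convolution; x = 0 stays at 0 and contributes nothing. -/
theorem aliveLogLaw_layer {Ω : Type*} [MeasurableSpace Ω] {P : Measure Ω} {d : ℕ} {σ : ℝ}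
    (hd : d ≠ 0) (hσ : 0 < σ) {M : Fin d × Fin d → Ω → ℝ} (hM : ∀ p, Measurable (M p))
    (hind : iIndepFun M P) (hlaw : ∀ p, P.map (M p) = gaussianReal 0 (Real.toNNReal (σ ^ 2)))
    {X : Ω → EuclideanSpace ℝ (Fin d)} (hX : Measurable X)
    (hXM : IndepFun X (fun ω i j => M (i, j) ω) P) :
    aliveLogLaw P (fun ω => layer relu (Matrix.of fun i j => M (i, j) ω) 0 (X ω)) =
      aliveLogLaw P X ∗ (aliveProb d • stepLaw d σ) := by
  have := hind.isProbabilityMeasure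
  have hMm : Measurable fun ω => fun i j => M (i, j) ω :=
    measurable_pi_lambda _ fun i => measurable_pi_lambda _ fun j => hM (i, j)
  have hlog : Measurable fun y : EuclideanSpace ℝ (Fin d) => Real.log ‖y‖ :=
    Real.measurable_log.comp measurable_norm
  have hne : MeasurableSet {y : EuclideanSpace ℝ (Fin d) | y ≠ 0} :=
    (measurableSet_singleton 0).compl
  have := isProbabilityMeasure_stepLaw hd σ
  have hpair := hXM.map_prod_eq_prod_map_map hX.aemeasurable hMm.aemeasurable
  ext B hB
  set A : Set (EuclideanSpace ℝ (Fin d)) := {y | y ≠ 0} ∩ (fun y => Real.log ‖y‖) ⁻¹' B with hA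
  have hAm : MeasurableSet A := hne.inter (hlog hB)
  have hal {Z : Ω → EuclideanSpace ℝ (Fin d)} (hZ : Measurable Z) :
      aliveLogLaw P Z B = P (Z ⁻¹' A) := by
    have hlZ : Measurable fun ω => Real.log ‖Z ω‖ := hlog.comp hZ
    rw [aliveLogLaw, Measure.map_apply hlZ hB, Measure.restrict_apply (hlZ hB), Set.inter_comm]
    rfl
  have hLp : Measurable fun p : EuclideanSpace ℝ (Fin d) × (Fin d → Fin d → ℝ) =>
      layer relu (Matrix.of p.2) 0 p.1 := Measurable.layer_relu measurable_snd measurable_fst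
  have hLc (x : EuclideanSpace ℝ (Fin d)) : Measurable fun ω =>
      layer relu (Matrix.of fun i j => M (i, j) ω) 0 x :=
    Measurable.layer_relu hMm measurable_const
  have hLX : Measurable fun ω => layer relu (Matrix.of fun i j => M (i, j) ω) 0 (X ω) :=
    Measurable.layer_relu hMm hX
  rw [hal hLX]
  have h1 : P ((fun ω => layer relu (Matrix.of fun i j => M (i, j) ω) 0 (X ω)) ⁻¹' A) =
      ∫⁻ x, P ((fun ω => layer relu (Matrix.of fun i j => M (i, j) ω) 0 x) ⁻¹' A) ∂P.map X := by
    have h2 := Measure.map_apply (μ := P) (hX.prodMk hMm) (hLp hAm)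
    rw [hpair, Measure.prod_apply (hLp hAm)] at h2
    refine h2.symm.trans (lintegral_congr fun x => ?_)
    rw [Measure.map_apply hMm (measurable_prodMk_left (hLp hAm))]
    rfl
  have h3 : ∀ x, P ((fun ω => layer relu (Matrix.of fun i j => M (i, j) ω) 0 x) ⁻¹' A) =
      {y : EuclideanSpace ℝ (Fin d) | y ≠ 0}.indicator
        (fun x => (aliveProb d • stepLaw d σ) ((fun y => Real.log ‖x‖ + y) ⁻¹' B)) x := by
    intro x
    by_cases hx : x = 0
    · subst hx
      rw [Set.indicator_of_notMem (by simp)]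
      have : (fun ω => layer relu (Matrix.of fun i j => M (i, j) ω) 0
          (0 : EuclideanSpace ℝ (Fin d))) ⁻¹' A = ∅ := by
        ext ω
        simp only [Set.mem_preimage, Set.mem_empty_iff_false, iff_false]
        intro h
        refine h.1 ?_
        ext i
        rw [layer_relu_apply]
        simp [relu]
      rw [this, measure_empty]
    · rw [Set.indicator_of_mem (show x ∈ {y : EuclideanSpace ℝ (Fin d) | y ≠ 0} from hx),
        ← hal (hLc x), aliveLogLaw_layer_const hσ hM hind hlaw hx,
        Measure.map_apply (by fun_prop) hB]
  have hadd : Measurable fun p : ℝ × ℝ => p.1 + p.2 := by fun_prop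
  have hm := measurable_measure_prodMk_left (ν := aliveProb d • stepLaw d σ) (hadd hB)
  have hlX : Measurable fun ω => Real.log ‖X ω‖ := hlog.comp hX
  rw [h1, lintegral_congr h3, lintegral_indicator hne, Measure.restrict_map hX hne, Measure.conv,
    Measure.map_apply hadd hB, Measure.prod_apply (hadd hB), aliveLogLaw, lintegral_map hm hlX]
  exact lintegral_map (hm.comp hlog) hX

/-! ### Independence across layers and reduction to a random walk. -/

theorem measurable_pi_pi {α ι κ β : Type*} {_ : MeasurableSpace α} [MeasurableSpace β]
    {f : α → ι → κ → β} (h : ∀ i j, Measurable fun a => f a i j) : Measurable f :=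
  measurable_pi_lambda _ fun i => measurable_pi_lambda _ fun j => h i j

/-- The output of depth k depends only on the weights with layer index below k. This sharp σ-algebra
is what makes it independent of `W k`. -/
theorem output_measurable_iSup {Ω : Type*} {d : ℕ} {W : ℕ → Ω → Matrix (Fin d) (Fin d) ℝ}
    {b : ℕ → EuclideanSpace ℝ (Fin d)} (hb : ∀ k, b k = 0) (x₀ : EuclideanSpace ℝ (Fin d))
    (k : ℕ) :
    Measurable[⨆ p ∈ {p : ℕ × Fin d × Fin d | p.1 < k},
      MeasurableSpace.comap (fun ω => W p.1 ω p.2.1 p.2.2) inferInstance]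
      fun ω => output relu (fun j => W j ω) b x₀ k := by
  induction k with
  | zero => exact measurable_const
  | succ k ih =>
    simp only [output, hb]
    refine Measurable.layer_relu (m := fun ω => W k ω) ?_ (ih.mono ?_ le_rfl)
    · refine measurable_pi_pi fun i j => ?_
      refine Measurable.mono (comap_measurable fun ω => W k ω i j) ?_ le_rfl
      exact le_iSup₂_of_le (k, i, j) (Nat.lt_succ_self k) le_rfl
    · exact biSup_mono fun p hp => Nat.lt_succ_of_lt hp

theorem measurable_output {Ω : Type*} [MeasurableSpace Ω] {d : ℕ}
    {W : ℕ → Ω → Matrix (Fin d) (Fin d) ℝ} (hW : ∀ k i j, Measurable fun ω => W k ω i j)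
    {b : ℕ → EuclideanSpace ℝ (Fin d)} (hb : ∀ k, b k = 0) (x₀ : EuclideanSpace ℝ (Fin d))
    (k : ℕ) : Measurable fun ω => output relu (fun j => W j ω) b x₀ k :=
  (output_measurable_iSup hb x₀ k).mono
    (iSup₂_le fun p _ => (hW p.1 p.2.1 p.2.2).comap_le) le_rfl

theorem indepFun_output {Ω : Type*} [MeasurableSpace Ω] {P : Measure Ω} {d : ℕ}
    {W : ℕ → Ω → Matrix (Fin d) (Fin d) ℝ} (hW : ∀ k i j, Measurable fun ω => W k ω i j)
    (hind : iIndepFun (fun (p : ℕ × Fin d × Fin d) ω => W p.1 ω p.2.1 p.2.2) P)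
    {b : ℕ → EuclideanSpace ℝ (Fin d)} (hb : ∀ k, b k = 0) (x₀ : EuclideanSpace ℝ (Fin d))
    (k : ℕ) : IndepFun (fun ω => output relu (fun j => W j ω) b x₀ k)
      (fun ω i j => W k ω i j) P := by
  have hdis : Disjoint {p : ℕ × Fin d × Fin d | p.1 < k} {p | p.1 = k} :=
    Set.disjoint_left.2 fun p (h1 : p.1 < k) (h2 : p.1 = k) => h1.ne h2
  have h := indep_iSup_of_disjoint
    (fun p : ℕ × Fin d × Fin d => (hW p.1 p.2.1 p.2.2).comap_le) hind hdis
  refine indep_of_indep_of_le_left (indep_of_indep_of_le_right h ?_)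
    (output_measurable_iSup hb x₀ k).comap_le
  refine Measurable.comap_le (measurable_pi_pi fun i j => ?_)
  refine Measurable.mono (comap_measurable fun ω => W k ω i j) ?_ le_rfl
  exact le_iSup₂_of_le (k, i, j) rfl le_rfl

/-- Law of the random walk started at `c` whose steps are independent with law `ν`. -/
noncomputable def walkLaw (ν : Measure ℝ) [IsProbabilityMeasure ν] (c : ℝ) (k : ℕ) : Measure ℝ :=
  (Measure.infinitePi fun _ : ℕ => ν).map fun ω => c + ∑ i ∈ Finset.range k, ω i

theorem iIndepFun_eval_infinitePi (ν : Measure ℝ) [IsProbabilityMeasure ν] :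
    iIndepFun (fun (i : ℕ) (ω : ℕ → ℝ) => ω i) (Measure.infinitePi fun _ : ℕ => ν) :=
  iIndepFun_infinitePi (X := fun _ x => x) fun _ => measurable_id

theorem walkLaw_zero (ν : Measure ℝ) [IsProbabilityMeasure ν] (c : ℝ) :
    walkLaw ν c 0 = Measure.dirac c := by
  simp [walkLaw, Measure.map_const]

instance (ν : Measure ℝ) [IsProbabilityMeasure ν] (c : ℝ) (k : ℕ) :
    IsProbabilityMeasure (walkLaw ν c k) :=
  Measure.isProbabilityMeasure_map (by fun_prop)

theorem walkLaw_succ (ν : Measure ℝ) [IsProbabilityMeasure ν] (c : ℝ) (k : ℕ) :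
    walkLaw ν c (k + 1) = walkLaw ν c k ∗ ν := by
  have h1 : IndepFun (∑ i ∈ Finset.range k, fun ω : ℕ → ℝ => ω i) (fun ω : ℕ → ℝ => ω k)
      (Measure.infinitePi fun _ : ℕ => ν) :=
    (iIndepFun_eval_infinitePi ν).indepFun_finsetSum_of_notMem
      (fun i => measurable_pi_apply i) Finset.notMem_range_self
  have h2 := h1.comp (φ := fun x => c + x) (ψ := id) (by fun_prop) measurable_id
  have h3 := h2.map_add_eq_map_conv_map (by fun_prop) (by fun_prop)
  have e1 : (fun ω : ℕ → ℝ => c + ∑ i ∈ Finset.range (k + 1), ω i) =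
      (fun x => c + x) ∘ (∑ i ∈ Finset.range k, fun ω : ℕ → ℝ => ω i) + id ∘ fun ω => ω k := by
    ext ω
    simp [Finset.sum_range_succ, add_assoc]
  have e2 : (fun ω : ℕ → ℝ => c + ∑ i ∈ Finset.range k, ω i) =
      (fun x => c + x) ∘ (∑ i ∈ Finset.range k, fun ω : ℕ → ℝ => ω i) := by
    ext ω
    simp
  rw [walkLaw, walkLaw, e1, e2, h3]
  congr 1
  exact Measure.infinitePi_map_eval (fun _ : ℕ => ν) k

theorem aliveLogLaw_output {Ω : Type*} [MeasurableSpace Ω] {P : Measure Ω} {d : ℕ} {σ : ℝ}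
    (hσ : 0 < σ) [IsProbabilityMeasure P] [IsProbabilityMeasure (stepLaw d σ)]
    {W : ℕ → Ω → Matrix (Fin d) (Fin d) ℝ} (hW : ∀ k i j, Measurable fun ω => W k ω i j)
    (hlaw : ∀ k i j, P.map (fun ω => W k ω i j) = gaussianReal 0 (Real.toNNReal (σ ^ 2)))
    (hind : iIndepFun (fun (p : ℕ × Fin d × Fin d) ω => W p.1 ω p.2.1 p.2.2) P)
    {b : ℕ → EuclideanSpace ℝ (Fin d)} (hb : ∀ k, b k = 0) {x₀ : EuclideanSpace ℝ (Fin d)}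
    (hx₀ : x₀ ≠ 0) (k : ℕ) :
    aliveLogLaw P (fun ω => output relu (fun j => W j ω) b x₀ k) =
      aliveProb d ^ k • walkLaw (stepLaw d σ) (Real.log ‖x₀‖) k := by
  have hd : d ≠ 0 := by
    rintro rfl
    exact hx₀ (Subsingleton.elim _ _)
  induction k with
  | zero => simp [aliveLogLaw, output, hx₀, walkLaw_zero, Measure.map_const]
  | succ k ih =>
    have hinj : Function.Injective fun p : Fin d × Fin d => (k, p) := Prod.mk_right_injective k
    have h := aliveLogLaw_layer hd hσ (M := fun p ω => W k ω p.1 p.2) (fun p => hW k p.1 p.2)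
      (hind.precomp hinj) (fun p => hlaw k p.1 p.2) (measurable_output hW hb x₀ k)
      (indepFun_output hW hind hb x₀ k)
    have e : (fun ω => output relu (fun j => W j ω) b x₀ (k + 1)) = fun ω =>
        layer relu (Matrix.of fun i j => W k ω i j) 0 (output relu (fun j => W j ω) b x₀ k) := by
      ext1 ω
      rw [output, hb]
      rfl
    rw [e, h, ih, walkLaw_succ, Measure.conv_smul_left, Measure.conv_smul_right, smul_smul,
      pow_succ]

theorem condLogNormLaw_output {Ω : Type*} [MeasurableSpace Ω] {P : Measure Ω} {d : ℕ} {σ : ℝ}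
    (hσ : 0 < σ) [IsProbabilityMeasure P] [IsProbabilityMeasure (stepLaw d σ)]
    {W : ℕ → Ω → Matrix (Fin d) (Fin d) ℝ} (hW : ∀ k i j, Measurable fun ω => W k ω i j)
    (hlaw : ∀ k i j, P.map (fun ω => W k ω i j) = gaussianReal 0 (Real.toNNReal (σ ^ 2)))
    (hind : iIndepFun (fun (p : ℕ × Fin d × Fin d) ω => W p.1 ω p.2.1 p.2.2) P)
    {b : ℕ → EuclideanSpace ℝ (Fin d)} (hb : ∀ k, b k = 0) {x₀ : EuclideanSpace ℝ (Fin d)}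
    (hx₀ : x₀ ≠ 0) (k : ℕ) :
    P {ω | output relu (fun j => W j ω) b x₀ k ≠ 0} ≠ 0 ∧
    condLogNormLaw P (fun ω => output relu (fun j => W j ω) b x₀ k) =
      walkLaw (stepLaw d σ) (Real.log ‖x₀‖) k := by
  have hd : d ≠ 0 := by
    rintro rfl
    exact hx₀ (Subsingleton.elim _ _)
  have h := aliveLogLaw_output hσ hW hlaw hind hb hx₀ k
  have hX := measurable_output hW hb x₀ k
  -- Comparing total masses: the walk law is a probability, so the scalar factor is the survival
  -- probability.
  have hP : P {ω | output relu (fun j => W j ω) b x₀ k ≠ 0} = aliveProb d ^ k := by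
    have h' := congrArg (fun μ : Measure ℝ => μ Set.univ) h
    simp only [Measure.smul_apply, measure_univ, smul_eq_mul, mul_one] at h'
    have hl : Measurable fun ω => Real.log ‖output relu (fun j => W j ω) b x₀ k‖ :=
      Real.measurable_log.comp hX.norm
    rwa [aliveLogLaw, Measure.map_apply hl MeasurableSet.univ, Set.preimage_univ,
      Measure.restrict_apply_univ] at h'
  have hne : P {ω | output relu (fun j => W j ω) b x₀ k ≠ 0} ≠ 0 := by
    rw [hP]
    exact pow_ne_zero _ (aliveProb_ne_zero hd)
  refine ⟨hne, ?_⟩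
  rw [aliveLogLaw] at h
  rw [condLogNormLaw, ProbabilityTheory.cond, Measure.map_smul, h, ← hP, smul_smul,
    ENNReal.inv_mul_cancel hne (measure_ne_top _ _), one_smul]

/-! ### Limit theorems for arbitrary couplings of the walk's marginals. -/

/-- The function t ↦ exp(-ta) mgf(t) equals 1 at 0 and has derivative (mean - a) < 0 there, so it
drops below 1 just to the right of 0. It is the geometric ratio in the Chernoff bound. -/
theorem exists_pos_mgf_mul_exp_lt_one {ν : Measure ℝ} [IsProbabilityMeasure ν]
    (h0 : 0 ∈ interior (integrableExpSet id ν)) {a : ℝ} (ha : ∫ x, x ∂ν < a) :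
    ∃ t, 0 < t ∧ t ∈ integrableExpSet id ν ∧ Real.exp (-t * a) * mgf id ν t < 1 := by
  have hm : HasDerivAt (mgf id ν) (∫ x, x ∂ν) 0 := by
    simpa using hasDerivAt_mgf h0
  have he : HasDerivAt (fun t : ℝ => Real.exp (-t * a)) (-a) 0 := by
    simpa using ((hasDerivAt_neg (0 : ℝ)).mul_const a).exp
  have hd : HasDerivAt (fun t => Real.exp (-t * a) * mgf id ν t) (∫ x, x ∂ν - a) 0 := by
    convert! he.mul hm using 1
    simp
    ring
  have hneg : ∫ x, x ∂ν - a < 0 := sub_neg.2 ha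
  have hslope := (hasDerivAt_iff_tendsto_slope.1 hd).eventually_lt_const hneg
  have h1 : ∀ᶠ t in 𝓝[>] (0 : ℝ),
      slope (fun t => Real.exp (-t * a) * mgf id ν t) 0 t < 0 :=
    hslope.filter_mono (nhdsWithin_mono _ fun t (ht : 0 < t) => ht.ne')
  have h2 : ∀ᶠ t in 𝓝[>] (0 : ℝ), t ∈ integrableExpSet id ν :=
    nhdsWithin_le_nhds (mem_interior_iff_mem_nhds.1 h0)
  obtain ⟨t, ⟨ht1, ht2⟩, ht⟩ := ((h1.and h2).and self_mem_nhdsWithin).exists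
  have ht : 0 < t := ht
  refine ⟨t, ht, ht2, ?_⟩
  rw [slope_def_field, sub_zero, div_neg_iff] at ht1
  rcases ht1 with h | h
  · exact absurd h.2 (not_lt.2 ht.le)
  · have := h.1
    simp only [neg_zero, zero_mul, Real.exp_zero, mgf_zero, mul_one] at this
    linarith

/-- Upper tails of a random walk with exponential moments decay geometrically. -/
theorem summable_measure_sum_ge {Ω : Type*} [MeasurableSpace Ω] {P : Measure Ω}
    [IsProbabilityMeasure P] {ν : Measure ℝ} [IsProbabilityMeasure ν] {X : ℕ → Ω → ℝ}
    (hX : ∀ i, Measurable (X i)) (hind : iIndepFun X P) (hlaw : ∀ i, P.map (X i) = ν)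
    (h0 : 0 ∈ interior (integrableExpSet id ν)) {a : ℝ} (ha : ∫ x, x ∂ν < a) :
    ∑' k : ℕ, P {ω | k * a ≤ ∑ i ∈ Finset.range k, X i ω} ≠ ⊤ := by
  obtain ⟨t, ht, hti, hq⟩ := exists_pos_mgf_mul_exp_lt_one h0 ha
  have hXi : ∀ i, Integrable (fun ω => Real.exp (t * X i ω)) P := fun i => by
    have : Integrable (fun x => Real.exp (t * id x)) ν := hti
    rw [← hlaw i] at this
    exact this.comp_measurable (hX i)
  have hXm : ∀ i, mgf (X i) P t = mgf id ν t := fun i => by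
    rw [← hlaw i, mgf_id_map (hX i).aemeasurable]
  set q := Real.exp (-t * a) * mgf id ν t with hqdef
  have hq0 : 0 ≤ q := mul_nonneg (Real.exp_pos _).le mgf_nonneg
  have hbound : ∀ k : ℕ, P {ω | k * a ≤ ∑ i ∈ Finset.range k, X i ω} ≤
      ENNReal.ofReal (q ^ k) := fun k => by
    have h := measure_ge_le_exp_mul_mgf (μ := P) (X := ∑ i ∈ Finset.range k, X i) (k * a) ht.le
      (hind.integrable_exp_mul_sum hX fun i _ => hXi i)
    rw [hind.mgf_sum hX, Finset.prod_congr rfl fun i _ => hXm i, Finset.prod_const,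
      Finset.card_range] at h
    have e : Real.exp (-t * (k * a)) * mgf id ν t ^ k = q ^ k := by
      rw [hqdef, mul_pow, ← Real.exp_nat_mul]
      ring_nf
    rw [e] at h
    simp only [Finset.sum_apply] at h
    rw [← ofReal_measureReal]
    exact ENNReal.ofReal_le_ofReal h
  refine ne_top_of_le_ne_top ?_ (ENNReal.tsum_le_tsum hbound)
  rw [← ENNReal.ofReal_tsum_of_nonneg (fun k => pow_nonneg hq0 k)
    (summable_geometric_of_lt_one hq0 hq)]
  exact ENNReal.ofReal_ne_top

theorem zero_mem_interior_integrableExpSet_map_neg {ν : Measure ℝ}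
    (h0 : 0 ∈ interior (integrableExpSet id ν)) :
    0 ∈ interior (integrableExpSet id (ν.map fun x => -x)) := by
  rw [mem_interior_iff_mem_nhds] at h0 ⊢
  have h1 : Tendsto (fun t : ℝ => -t) (𝓝 0) (𝓝 0) := by
    simpa using (continuous_neg.tendsto (0 : ℝ))
  filter_upwards [h1 h0] with t ht
  have ht : Integrable (fun x => Real.exp (-t * id x)) ν := ht
  refine (integrable_map_measure (by fun_prop) (by fun_prop)).2 ?_
  refine ht.congr (Eventually.of_forall fun x => ?_)
  simp

/-- The input to Borel–Cantelli. The lower tail is the upper tail of the reflected walk. -/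
theorem tsum_walkLaw_ne_top {ν : Measure ℝ} [IsProbabilityMeasure ν]
    (h0 : 0 ∈ interior (integrableExpSet id ν)) (c : ℝ) {ε : ℝ} (hε : 0 < ε) :
    ∑' k : ℕ, walkLaw ν c k {y | k * ε ≤ |y - c - k * ∫ x, x ∂ν|} ≠ ⊤ := by
  set P := Measure.infinitePi fun _ : ℕ => ν with hP
  set m := ∫ x, x ∂ν with hm
  have hlaw : ∀ i : ℕ, P.map (fun ω => ω i) = ν := fun i =>
    Measure.infinitePi_map_eval (fun _ : ℕ => ν) i
  have hind := iIndepFun_eval_infinitePi ν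
  have up := summable_measure_sum_ge (P := P) (fun i => measurable_pi_apply i) hind hlaw h0
    (a := m + ε) (by linarith)
  have : IsProbabilityMeasure (ν.map fun x => -x) := Measure.isProbabilityMeasure_map (by fun_prop)
  have hind' : iIndepFun (fun (i : ℕ) (ω : ℕ → ℝ) => -ω i) P :=
    hind.comp (fun _ x => -x) fun _ => measurable_neg
  have lo := summable_measure_sum_ge (P := P) (X := fun i ω => -ω i)
    (ν := ν.map fun x => -x) (fun i => (measurable_pi_apply i).neg) hind' (fun i => by
      rw [← hlaw i]
      exact (Measure.map_map (g := fun x : ℝ => -x) measurable_neg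
        (measurable_pi_apply i)).symm)
    (zero_mem_interior_integrableExpSet_map_neg h0) (a := -m + ε) (by
      rw [integral_map (by fun_prop) (by fun_prop), integral_neg]
      linarith)
  refine ne_top_of_le_ne_top (ENNReal.add_ne_top.2 ⟨up, lo⟩) ?_
  rw [← ENNReal.tsum_add]
  refine ENNReal.tsum_le_tsum fun k => ?_
  rw [walkLaw, Measure.map_apply (by fun_prop)
    (measurableSet_le measurable_const (by fun_prop))]
  refine (measure_mono ?_).trans (measure_union_le _ _)
  intro ω hω
  have hω : (k : ℝ) * ε ≤ |c + ∑ i ∈ Finset.range k, ω i - c - k * m| := hω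
  rcases le_abs.1 hω with h | h
  · left
    change (k : ℝ) * (m + ε) ≤ ∑ i ∈ Finset.range k, ω i
    linarith
  · right
    change (k : ℝ) * (-m + ε) ≤ ∑ i ∈ Finset.range k, -ω i
    rw [Finset.sum_neg_distrib]
    linarith

/-- A strong law of large numbers that holds for every coupling of the walk's marginals. -/
theorem ae_tendsto_div_of_hasLaw_walkLaw {ν : Measure ℝ} [IsProbabilityMeasure ν]
    (h0 : 0 ∈ interior (integrableExpSet id ν)) (c : ℝ) {Ω : Type*} [MeasurableSpace Ω]
    {Q : Measure Ω} {R : ℕ → Ω → ℝ} (hR : ∀ k, HasLaw (R k) (walkLaw ν c k) Q) :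
    ∀ᵐ ω ∂Q, Tendsto (fun k : ℕ => R k ω / k) atTop (𝓝 (∫ x, x ∂ν)) := by
  set m := ∫ x, x ∂ν with hm
  have key : ∀ n : ℕ, ∀ᵐ ω ∂Q, ∀ᶠ k : ℕ in atTop,
      ¬ (k * ((n : ℝ) + 1)⁻¹ ≤ |R k ω - c - k * m|) := fun n => by
    have h := tsum_walkLaw_ne_top h0 c (ε := ((n : ℝ) + 1)⁻¹) (by positivity)
    have e : ∀ k : ℕ, walkLaw ν c k {y | k * ((n : ℝ) + 1)⁻¹ ≤ |y - c - k * m|} =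
        Q {ω | k * ((n : ℝ) + 1)⁻¹ ≤ |R k ω - c - k * m|} := fun k =>
      ((hR k).measure_eq (measurableSet_le measurable_const (by fun_prop))).symm
    simp only [← hm, e] at h
    -- The first Borel–Cantelli lemma needs no independence, so the joint law of the `R k` plays no
    -- role.
    exact ae_eventually_notMem h
  filter_upwards [ae_all_iff.2 key] with ω hω
  have h1 : Tendsto (fun k : ℕ => (R k ω - c - k * m) / k) atTop (𝓝 0) := by
    rw [Metric.tendsto_nhds]
    intro ε hε
    obtain ⟨n, hn⟩ := exists_nat_one_div_lt hε
    filter_upwards [hω n, eventually_gt_atTop 0] with k hk hk0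
    have hk0 : (0 : ℝ) < k := Nat.cast_pos.2 hk0
    rw [Real.dist_eq, sub_zero, abs_div, abs_of_pos hk0, div_lt_iff₀ hk0]
    rw [not_le] at hk
    rw [one_div] at hn
    nlinarith
  have h2 : Tendsto (fun k : ℕ => c / (k : ℝ)) atTop (𝓝 0) :=
    tendsto_const_div_atTop_nhds_zero_nat c
  have h3 := (h1.add h2).add_const m
  rw [zero_add, zero_add] at h3
  refine h3.congr' ?_
  filter_upwards [eventually_gt_atTop 0] with k hk
  have hk : (k : ℝ) ≠ 0 := Nat.cast_ne_zero.2 hk.ne'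
  field_simp
  ring

/-- The central limit theorem for the marginals of a random walk, in an arbitrary coupling. -/
theorem tendstoInDistribution_of_hasLaw_walkLaw {ν : Measure ℝ} [IsProbabilityMeasure ν]
    (h2 : MemLp id 2 ν) (c : ℝ) {Ω : Type*} [MeasurableSpace Ω] {Q : Measure Ω}
    [IsProbabilityMeasure Q] {R : ℕ → Ω → ℝ} (hR : ∀ k, HasLaw (R k) (walkLaw ν c k) Q) :
    TendstoInDistribution (fun (k : ℕ) ω => (R k ω - (∫ x, x ∂ν) * k) / √k) atTop id
      (fun _ => Q) (gaussianReal 0 (Real.toNNReal Var[id; ν])) := by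
  set P := Measure.infinitePi fun _ : ℕ => ν with hP
  set m := ∫ x, x ∂ν with hm
  have hlaw : ∀ i : ℕ, P.map (fun ω => ω i) = ν := fun i =>
    Measure.infinitePi_map_eval (fun _ : ℕ => ν) i
  have hid : ∀ i : ℕ, IdentDistrib (fun ω : ℕ → ℝ => ω i) id P ν := fun i =>
    ⟨(measurable_pi_apply i).aemeasurable, by fun_prop, by rw [hlaw, Measure.map_id]⟩
  have hvar : Var[fun ω : ℕ → ℝ => ω 0; P] = Var[id; ν] := (hid 0).variance_eq
  have hmean : ∫ ω, ω 0 ∂P = m := (hid 0).integral_eq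
  have hclt := tendstoInDistribution_inv_sqrt_mul_sum_sub (P := P)
    (X := fun (i : ℕ) (ω : ℕ → ℝ) => ω i) (Y := id)
    (P' := gaussianReal 0 (Real.toNNReal Var[id; ν]))
    ⟨by fun_prop, by rw [hvar, Measure.map_id]⟩ ((hid 0).memLp_iff.2 h2)
    (iIndepFun_eval_infinitePi ν) (fun i => (hid i).trans (hid 0).symm)
  -- The starting point c contributes c/√k → 0, absorbed by Slutsky's theorem.
  have hconst : TendstoInMeasure P (fun (k : ℕ) (_ : ℕ → ℝ) => c / √(k : ℝ)) atTop fun _ => 0 := by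
    refine tendstoInMeasure_of_tendsto_ae (fun k => aestronglyMeasurable_const) ?_
    refine Eventually.of_forall fun _ => ?_
    exact tendsto_const_nhds.div_atTop (Real.tendsto_sqrt_atTop.comp tendsto_natCast_atTop_atTop)
  have hsum := hclt.add_of_tendstoInMeasure_const hconst fun k => aemeasurable_const
  have hmeas : ∀ k : ℕ, AEMeasurable (fun ω => (R k ω - m * k) / √k) Q := fun k =>
    (((hR k).aemeasurable.sub_const _).div_const _)
  refine ⟨hmeas, by fun_prop, ?_⟩
  convert! hsum.tendsto using 2
  -- Only the law of each `R k` matters here, so it may be replaced by the walk on the product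
  -- space.
  · refine congrArg Tendsto (funext fun k => Subtype.ext ?_)
    have e1 : Q.map (fun ω => (R k ω - m * k) / √k) =
        (Q.map (R k)).map fun y => (y - m * k) / √k :=
      (AEMeasurable.map_map_of_aemeasurable (g := fun y => (y - m * k) / √k) (by fun_prop)
        (hR k).aemeasurable).symm
    change Q.map (fun ω => (R k ω - m * k) / √k) = _
    rw [e1, (hR k).map_eq, walkLaw, Measure.map_map (by fun_prop) (by fun_prop)]
    refine congrArg₂ Measure.map ?_ rfl
    ext ω
    simp only [Function.comp, Pi.add_apply, hmean]
    ring
  · refine congrArg 𝓝 (Subtype.ext ?_)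
    simp only [add_zero]

end GaussianNet

theorem mainTheorem3 {d : ℕ} {σ : ℝ} (hσ : 0 < σ)
    {Ω : Type*} [MeasurableSpace Ω] (P : Measure Ω) [IsProbabilityMeasure P]
    (W : ℕ → Ω → Matrix (Fin d) (Fin d) ℝ)
    (hWmeas : ∀ k i j, Measurable fun ω => W k ω i j)
    (hWlaw : ∀ k i j, P.map (fun ω => W k ω i j) = gaussianReal 0 (Real.toNNReal (σ ^ 2)))
    (hWindep : iIndepFun (fun (p : ℕ × Fin d × Fin d) ω => W p.1 ω p.2.1 p.2.2) P)
    (b : ℕ → EuclideanSpace ℝ (Fin d)) (hb : ∀ k, b k = 0)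
    (x₀ : EuclideanSpace ℝ (Fin d)) (hx₀ : x₀ ≠ 0) :
    (∀ k, P {ω | GaussianNet.output GaussianNet.relu (fun j => W j ω) b x₀ k ≠ 0} ≠ 0) ∧
    0 ≤ GaussianNet.limitVariance d ∧
    ∀ {Ω' : Type*} [MeasurableSpace Ω'] (Q : Measure Ω') [IsProbabilityMeasure Q]
      (R : ℕ → Ω' → ℝ),
      (∀ k, HasLaw (R k)
        (GaussianNet.condLogNormLaw P
          fun ω => GaussianNet.output GaussianNet.relu (fun j => W j ω) b x₀ k) Q) →
      (∀ᵐ ω ∂Q, Tendsto (fun k : ℕ => R k ω / k) atTop (𝓝 (GaussianNet.meanRate d σ))) ∧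
      TendstoInDistribution
        (fun (k : ℕ) ω => (R k ω - GaussianNet.meanRate d σ * k) / Real.sqrt k) atTop
        id (fun _ => Q) (gaussianReal 0 (Real.toNNReal (GaussianNet.limitVariance d))) := by
  have hd : d ≠ 0 := by
    rintro rfl
    exact hx₀ (Subsingleton.elim _ _)
  have := GaussianNet.isProbabilityMeasure_stepLaw hd σ
  have hcond := GaussianNet.condLogNormLaw_output hσ hWmeas hWlaw hWindep hb hx₀
  have h0 := GaussianNet.zero_mem_interior_integrableExpSet_stepLaw d σ
  refine ⟨fun k => (hcond k).1, GaussianNet.limitVariance_nonneg hd, fun Q _ R hR => ?_⟩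
  have hR' : ∀ k, HasLaw (R k)
      (GaussianNet.walkLaw (GaussianNet.stepLaw d σ) (Real.log ‖x₀‖) k) Q := fun k =>
    (hcond k).2 ▸ hR k
  rw [← GaussianNet.integral_id_stepLaw hd σ, ← GaussianNet.variance_id_stepLaw hd σ]
  exact ⟨GaussianNet.ae_tendsto_div_of_hasLaw_walkLaw h0 _ hR',
    GaussianNet.tendstoInDistribution_of_hasLaw_walkLaw
      (memLp_of_mem_interior_integrableExpSet h0 2) _ hR'⟩
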